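/- Let $F\in\{\mathbb R,\mathbb C\}$ and let $B$ be an associative unital $F$-algebra with involution $*$ (conjugate-linear over $F$). Let $B_h=\{b\in B: b^*=b\}$, a real vector space equipped with its finest locally convex topology, and let $Z(B)$ be the center of $B$. Let $(B_h)'$ be the space of all real-linear functionals on $B_h$, with the topology of pointwise convergence. A set $M\subseteq B_h$ is a quadratic module if $1\in M$, $M+M\subseteq M$ and $b^*Mb\subseteq M$ for every $b\in B$; it is archimedean if for every $x\in B_h$ there is $l\in\mathbb N$ with $l+x\in M$ and $l-x\in M$. Write $M^\vee$ for the set of $M$-positive states, i.e. of all $f\in(B_h)'$ with $f(1)=1$ and $f(m)\ge 0$ for all $m\in M$, and $\operatorname{extr}M^\vee$ for its set of extreme points. A functional $f\in (B_h)'$ is factorizable if $f(xy)=f(x)f(y)$ for all $x\in B_h$ and $y\in Z(B)\cap B_h$. A $*$-representation of $B$ is a homomorphism $\pi$ of unital $*$-algebras over $F$ from $B$ to the algebra of bounded operators on some Hilbert space over $F$; it is $M$-positive if $\pi(m)$ is positive semidefinite for every $m\in M$. A bounded operator $T$ is strictly positive definite if $T-\varepsilon$ is positive semidefinite for some real $\varepsilon>0$.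 Let $M$ be an archimedean quadratic module in $B$ and let $b\in B_h$. Then the following are equivalent: 1. $b$ lies in the interior $M^\circ$ of $M$; 2. $b\in\varepsilon+M$ for some real $\varepsilon>0$; 3. $\pi(b)$ is strictly positive definite for every $M$-positive $*$-representation $\pi$ of $B$; 4. $f(b)>0$ for every $f\in M^\vee$; 5. $f(b)>0$ for every $f\in\overline{\operatorname{extr}M^\vee}$; 6. $f(b)>0$ for every factorizable $f\in M^\vee$. The following are also equivalent: 1. $b$ lies in the closure $\overline M$ of $M$; 2. $b+\varepsilon\in M$ for every real $\varepsilon>0$; 3. $\pi(b)$ is positive semidefinite for every $M$-positive $*$-representation $\pi$ of $B$; 4. $f(b)\ge 0$ for every $f\in M^\vee$; 5. $f(b)\ge 0$ for every $f\in\overline{\operatorname{extr}M^\vee}$; 6. $f(b)\ge 0$ for every factorizable $f\in M^\vee$. -/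

import Mathlib

open Topology

universe u v

namespace StarPositivity

/-- The finest locally convex vector space topology on a real vector space `E`: the join of all
locally convex vector space topologies. (In Mathlib's order on topologies smaller means finer,
so this join is `sInf`.) -/
abbrev finestLocallyConvex (E : Type*) [AddCommGroup E] [Module ℝ E] : TopologicalSpace E :=
  sInf {t | @IsTopologicalAddGroup E t _ ∧ @ContinuousSMul ℝ E _ _ t ∧
    @LocallyConvexSpace ℝ E _ _ _ _ t}

/-- The finest locally convex topology is itself a locally convex vector space topology. -/
theorem finestLocallyConvex_spec (E : Type*) [AddCommGroup E] [Module ℝ E] :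
    @IsTopologicalAddGroup E (finestLocallyConvex E) _ ∧
      @ContinuousSMul ℝ E _ _ (finestLocallyConvex E) ∧
      @LocallyConvexSpace ℝ E _ _ _ _ (finestLocallyConvex E) :=
  ⟨topologicalAddGroup_sInf fun _ h => h.1, continuousSMul_sInf fun _ h => h.2.1,
    LocallyConvexSpace.sInf fun _ h => h.2.2⟩

/-- The weak* topology, i.e. the topology of pointwise convergence, on the algebraic dual. -/
abbrev weakStar (E : Type*) [AddCommGroup E] [Module ℝ E] : TopologicalSpace (Module.Dual ℝ E) :=
  TopologicalSpace.induced (fun (f : Module.Dual ℝ E) (x : E) => f x) Pi.topologicalSpace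

section Ring

variable {B : Type*} [Ring B] [StarRing B]

/-- The hermitian element `b* m b`, for `m` hermitian and `b` arbitrary. -/
def conj (b : B) (m : selfAdjoint B) : selfAdjoint B :=
  ⟨star b * (m : B) * b, m.2.conjugate' b⟩

/-- The hermitian element `x y`, for `x` hermitian and `y` hermitian and central. -/
def mulCentral (x y : selfAdjoint B) (hy : (y : B) ∈ Set.center B) : selfAdjoint B :=
  ⟨(x : B) * (y : B), by
    rw [selfAdjoint.mem_iff, star_mul, selfAdjoint.mem_iff.mp x.2, selfAdjoint.mem_iff.mp y.2]
    exact ((Set.mem_center_iff.mp hy).comm (x : B)).eq⟩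

/-- A quadratic module: a set of hermitian elements with `1 ∈ M`, `M + M ⊆ M` and
`b* M b ⊆ M` for every `b`. -/
structure IsQuadraticModule (M : Set (selfAdjoint B)) : Prop where
  one_mem : 1 ∈ M
  add_mem : ∀ x ∈ M, ∀ y ∈ M, x + y ∈ M
  conj_mem : ∀ (b : B), ∀ m ∈ M, conj b m ∈ M

/-- `M` is archimedean: every hermitian `b` is bounded with respect to `M`, i.e. `l + b` and
`l - b` lie in `M` for some natural number `l`. -/
def IsArchimedean (M : Set (selfAdjoint B)) : Prop :=
  ∀ b : selfAdjoint B, ∃ l : ℕ, (l : selfAdjoint B) + b ∈ M ∧ (l : selfAdjoint B) - b ∈ M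

section Dual

variable [Algebra ℝ B] [StarModule ℝ B]

/-- The set of `M`-positive states: real linear functionals `f` on the hermitian elements with
`f 1 = 1` and `f ≥ 0` on `M`. -/
def positiveStates (M : Set (selfAdjoint B)) : Set (Module.Dual ℝ (selfAdjoint B)) :=
  {f | f 1 = 1 ∧ ∀ m ∈ M, 0 ≤ f m}

/-- The extreme `M`-positive states. -/
def extremeStates (M : Set (selfAdjoint B)) : Set (Module.Dual ℝ (selfAdjoint B)) :=
  Set.extremePoints ℝ (positiveStates M)

/-- `f` is factorizable: `f (x y) = f x * f y` for `x` hermitian and `y` hermitian and central. -/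
def IsFactorizable (f : Module.Dual ℝ (selfAdjoint B)) : Prop :=
  ∀ (x y : selfAdjoint B) (hy : (y : B) ∈ Set.center B), f (mulCentral x y hy) = f x * f y

end Dual

section Representation

variable {𝕜 : Type*} [RCLike 𝕜] [Algebra 𝕜 B]
  {H : Type*} [NormedAddCommGroup H] [InnerProductSpace 𝕜 H] [CompleteSpace H]

/-- A `*`-representation by bounded operators is `M`-positive if it maps `M` to positive
semidefinite operators. -/
def IsPositiveRep (M : Set (selfAdjoint B)) (π : B →⋆ₐ[𝕜] (H →L[𝕜] H)) : Prop :=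
  ∀ m ∈ M, (π (m : B)).IsPositive

/-- A bounded operator `T` is strictly positive definite if `T - ε` is positive semidefinite for
some real `ε > 0`. -/
def IsStrictlyPositiveOp (T : H →L[𝕜] H) : Prop :=
  ∃ ε : ℝ, 0 < ε ∧ (T - (ε : 𝕜) • (1 : H →L[𝕜] H)).IsPositive

end Representation

end Ring

end StarPositivity

/-! An archimedean quadratic module is a convex cone with order unit `1`, since scaling by `c ≥ 0`
is conjugation by `√c`. Order intervals `[-ε, ε]` are neighbourhoods of `0` in the finest locally
convex topology, so interior and closure amount to moving by multiples of `1`. Hahn–Banach yields a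
state attaining the best lower bound of `b` by multiples of `1` (`exists_functional`), so positivity
on all states puts `b` back in `M` up to `ε`.

States and representations correspond by GNS: `f b = ⟨Ω, π(b)Ω⟩`, with `π` bounded because `a* a ≤
l`. The states form a weak* compact set, so evaluation at `b` attains its minimum at an extreme
state (`exists_mem_extremeStates_le`), and even strict inequalities need checking only there.

Extreme states are factorizable: for central `0 ≤ y ≤ 1`, `f` is a mixture of the normalized
functionals `f(· y)` and `f(· (1 - y))`. These are `M`-positive (`hermitianExtension_mul_nonneg`),
since `y` is a sum of squares of central elements up to a small remainder. -/

namespace StarPositivity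

/-! ### Cones with order unit: Hahn–Banach, interior and closure. -/

section OrderUnit

variable {E : Type*} [AddCommGroup E] [Module ℝ E]

/-- A convex cone `C` in a real vector space with order unit `e`. -/
structure IsOrderUnitCone (C : Set E) (e : E) : Prop where
  unit_mem : e ∈ C
  add_mem : ∀ x ∈ C, ∀ y ∈ C, x + y ∈ C
  smul_mem : ∀ c : ℝ, 0 ≤ c → ∀ x ∈ C, c • x ∈ C
  exists_smul_add_mem : ∀ x : E, ∃ l : ℝ, l • e + x ∈ C

/-- The upper bound functional `x ↦ inf {r | x ≤ r e}` of an order unit cone. -/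
noncomputable def upperGauge (C : Set E) (e x : E) : ℝ := sInf {r : ℝ | r • e - x ∈ C}

namespace IsOrderUnitCone

variable {C : Set E} {e : E} (hC : IsOrderUnitCone C e)
include hC

theorem smul_unit_add_mem_of_le {r s : ℝ} (h : r ≤ s) {x : E} (hx : r • e + x ∈ C) :
    s • e + x ∈ C := by
  have := hC.add_mem _ (hC.smul_mem (s - r) (sub_nonneg.2 h) e hC.unit_mem) _ hx
  rwa [← add_assoc, ← add_smul, sub_add_cancel] at this

/-- This settles the degenerate case, in which there are no states and `upperGauge` is not bounded
below. -/
theorem eq_univ_of_neg_unit_mem (h : -e ∈ C) (x : E) : x ∈ C := by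
  obtain ⟨l, hl⟩ := hC.exists_smul_add_mem x
  have h1 := hC.smul_unit_add_mem_of_le (le_max_left l 0) hl
  have := hC.add_mem _ h1 _ (hC.smul_mem (max l 0) (le_max_right _ _) _ h)
  simpa using this

theorem upperGauge_set_nonempty (x : E) : {r : ℝ | r • e - x ∈ C}.Nonempty := by
  obtain ⟨l, hl⟩ := hC.exists_smul_add_mem (-x)
  exact ⟨l, by simpa [sub_eq_add_neg] using hl⟩

theorem unit_neg_of_smul_neg {r : ℝ} (hr : r < 0) (h : r • e ∈ C) : -e ∈ C := by
  have := hC.smul_mem (-r)⁻¹ (inv_nonneg.2 (by linarith)) _ h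
  rwa [smul_smul, inv_neg, neg_mul, inv_mul_cancel₀ hr.ne, neg_one_smul] at this

theorem upperGauge_set_bddBelow (he : -e ∉ C) (x : E) : BddBelow {r : ℝ | r • e - x ∈ C} := by
  obtain ⟨l, hl⟩ := hC.exists_smul_add_mem x
  refine ⟨-l, fun r hr => ?_⟩
  by_contra hlt
  refine he (hC.unit_neg_of_smul_neg (r := r + l) (by linarith) ?_)
  have := hC.add_mem _ hr _ hl
  rwa [show r • e - x + (l • e + x) = (r + l) • e by module] at this

theorem upperGauge_le (he : -e ∉ C) {x : E} {r : ℝ} (h : r • e - x ∈ C) :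
    upperGauge C e x ≤ r :=
  csInf_le (hC.upperGauge_set_bddBelow he x) h

theorem mem_of_upperGauge_lt {x : E} {r : ℝ} (h : upperGauge C e x < r) : r • e - x ∈ C := by
  obtain ⟨s, hs, hsr⟩ := exists_lt_of_csInf_lt (hC.upperGauge_set_nonempty x) h
  rw [sub_eq_add_neg]
  exact hC.smul_unit_add_mem_of_le hsr.le (by simpa [sub_eq_add_neg] using hs)

theorem upperGauge_add_le (he : -e ∉ C) (x y : E) :
    upperGauge C e (x + y) ≤ upperGauge C e x + upperGauge C e y := by
  refine le_of_forall_pos_le_add fun ε hε => ?_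
  have hx := hC.mem_of_upperGauge_lt (x := x) (lt_add_of_pos_right _ (half_pos hε))
  have hy := hC.mem_of_upperGauge_lt (x := y) (lt_add_of_pos_right _ (half_pos hε))
  refine (hC.upperGauge_le he (r := (upperGauge C e x + ε / 2) + (upperGauge C e y + ε / 2))
    ?_).trans (by linarith)
  have := hC.add_mem _ hx _ hy
  rwa [add_smul, add_sub_add_comm]

theorem upperGauge_smul_le (he : -e ∉ C) {c : ℝ} (hc : 0 < c) (x : E) :
    upperGauge C e (c • x) ≤ c * upperGauge C e x := by
  refine le_of_forall_pos_le_add fun ε hε => ?_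
  have hx := hC.mem_of_upperGauge_lt (x := x) (lt_add_of_pos_right _ (div_pos hε hc))
  refine (hC.upperGauge_le he (r := c * (upperGauge C e x + ε / c)) ?_).trans ?_
  · rw [mul_smul, ← smul_sub]
    exact hC.smul_mem c hc.le _ hx
  · rw [mul_add, mul_div_cancel₀ _ hc.ne']

theorem upperGauge_smul (he : -e ∉ C) {c : ℝ} (hc : 0 < c) (x : E) :
    upperGauge C e (c • x) = c * upperGauge C e x := by
  refine (hC.upperGauge_smul_le he hc x).antisymm ?_
  have := hC.upperGauge_smul_le he (inv_pos.2 hc) (c • x)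
  rwa [inv_smul_smul₀ hc.ne', ← div_eq_inv_mul, le_div_iff₀' hc] at this

theorem upperGauge_zero (he : -e ∉ C) : upperGauge C e 0 = 0 := by
  have := hC.upperGauge_smul he (two_pos) 0
  rw [smul_zero] at this
  linarith

/-- If `-e ∉ C`, some linear functional is normalized and nonnegative on `C`, and attains at `b`
the largest lower bound of `b` by multiples of `e`. -/
theorem exists_functional (he : -e ∉ C) (b : E) : ∃ g : E →ₗ[ℝ] ℝ,
    g e = 1 ∧ (∀ m ∈ C, 0 ≤ g m) ∧ g b = -upperGauge C e (-b) := by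
  have key : ∃ g : E →ₗ[ℝ] ℝ, (∀ x, g x ≤ upperGauge C e x) ∧ g b = -upperGauge C e (-b) := by
    -- Domination on the line through `b`: equality for `t < 0` by homogeneity; for `t > 0` from `0
    -- = p(b - b) ≤ p(b) + p(-b)`.
    have hle : ∀ t : ℝ, t * -upperGauge C e (-b) ≤ upperGauge C e (t • b) := by
      intro t
      rcases lt_trichotomy t 0 with ht | rfl | ht
      · have := hC.upperGauge_smul he (neg_pos.2 ht) (-b)
        rw [neg_smul_neg] at this
        linarith
      · simp [hC.upperGauge_zero he]
      · rw [hC.upperGauge_smul he ht]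
        have := hC.upperGauge_add_le he b (-b)
        rw [add_neg_cancel, hC.upperGauge_zero he] at this
        exact mul_le_mul_of_nonneg_left (by linarith) ht.le
    by_cases hb : b = 0
    · subst hb
      obtain ⟨g, -, hg⟩ := exists_extension_of_le_sublinear (⊥ : E →ₗ.[ℝ] ℝ) (upperGauge C e)
        (fun c hc x => hC.upperGauge_smul he hc x) (hC.upperGauge_add_le he) (by
          intro x
          obtain rfl : x = 0 := Subtype.ext x.2
          rw [LinearPMap.map_zero]
          exact (hC.upperGauge_zero he).ge)
      exact ⟨g, hg, by simp [hC.upperGauge_zero he]⟩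
    · obtain ⟨g, hgf, hg⟩ := exists_extension_of_le_sublinear
        (LinearPMap.mkSpanSingleton b (-upperGauge C e (-b)) hb) (upperGauge C e)
        (fun c hc x => hC.upperGauge_smul he hc x) (hC.upperGauge_add_le he) (by
          rintro ⟨x, hx⟩
          obtain ⟨t, rfl⟩ := Submodule.mem_span_singleton.1 hx
          have := LinearPMap.mkSpanSingleton'_apply b (-upperGauge C e (-b))
            (fun c hc => by simp [(smul_eq_zero.1 hc).resolve_right hb]) t hx
          exact this.trans_le (hle t))
      refine ⟨g, hg, (hgf ⟨b, Submodule.mem_span_singleton_self b⟩).trans ?_⟩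
      exact LinearPMap.mkSpanSingleton_apply ℝ ℝ hb (-upperGauge C e (-b))
  obtain ⟨g, hg, hgb⟩ := key
  refine ⟨g, le_antisymm ?_ ?_, fun m hm => ?_, hgb⟩
  · refine (hg e).trans (hC.upperGauge_le he ?_)
    simpa using hC.smul_mem 0 le_rfl e hC.unit_mem
  · have := (hg (-e)).trans (hC.upperGauge_le (r := -1) he (by
      simpa using hC.smul_mem 0 le_rfl e hC.unit_mem))
    rw [map_neg] at this
    linarith
  · have := (hg (-m)).trans (hC.upperGauge_le (r := 0) he (by simpa using hm))
    rw [map_neg] at this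
    linarith

theorem exists_eq_smul_add_of_forall_pos {b : E}
    (h : ∀ f : E →ₗ[ℝ] ℝ, f e = 1 → (∀ m ∈ C, 0 ≤ f m) → 0 < f b) :
    ∃ ε : ℝ, 0 < ε ∧ ∃ m ∈ C, b = ε • e + m := by
  by_cases he : -e ∈ C
  · exact ⟨1, one_pos, b - e, hC.eq_univ_of_neg_unit_mem he _, by simp⟩
  obtain ⟨g, hg1, hg, hgb⟩ := hC.exists_functional he b
  have hpos := h g hg1 hg
  rw [hgb] at hpos
  -- The gauge of `-b` is negative, so half of it lies strictly above the infimum and is still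
  -- negative.
  have := hC.mem_of_upperGauge_lt (x := -b) (r := upperGauge C e (-b) / 2) (by linarith)
  exact ⟨-(upperGauge C e (-b) / 2), by linarith, _, this, by module⟩

theorem add_smul_mem_of_forall_nonneg {b : E}
    (h : ∀ f : E →ₗ[ℝ] ℝ, f e = 1 → (∀ m ∈ C, 0 ≤ f m) → 0 ≤ f b) {ε : ℝ} (hε : 0 < ε) :
    b + ε • e ∈ C := by
  by_cases he : -e ∈ C
  · exact hC.eq_univ_of_neg_unit_mem he _
  obtain ⟨g, hg1, hg, hgb⟩ := hC.exists_functional he b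
  have hpos := h g hg1 hg
  rw [hgb] at hpos
  have := hC.mem_of_upperGauge_lt (x := -b) (r := ε) (by linarith)
  rwa [sub_neg_eq_add, add_comm] at this

/-- The order interval `[-e, e]` is a neighbourhood of zero in the finest locally convex
topology. -/
theorem orderInterval_mem_nhds :
    {x : E | e + x ∈ C ∧ e - x ∈ C} ∈ @nhds E (finestLocallyConvex E) 0 := by
  set S : Set E := {x : E | e + x ∈ C ∧ e - x ∈ C} with hS
  have hneg : ∀ x ∈ S, -x ∈ S := fun x hx =>
    ⟨by simpa [sub_eq_add_neg] using hx.2, by simpa using hx.1⟩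
  have hconv : Convex ℝ S := by
    intro x hx y hy a c ha hc hac
    constructor
    · have := hC.add_mem _ (hC.smul_mem a ha _ hx.1) _ (hC.smul_mem c hc _ hy.1)
      rwa [show a • (e + x) + c • (e + y) = (a + c) • e + (a • x + c • y) by module, hac,
        one_smul] at this
    · have := hC.add_mem _ (hC.smul_mem a ha _ hx.2) _ (hC.smul_mem c hc _ hy.2)
      rwa [show a • (e - x) + c • (e - y) = (a + c) • e - (a • x + c • y) by module, hac,
        one_smul] at this
  have h0 : (0 : E) ∈ S := by simp [hS, hC.unit_mem]
  have hbal : Balanced ℝ S := by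
    refine balanced_iff_smul_mem.2 fun a ha x hx => ?_
    rw [Real.norm_eq_abs] at ha
    rcases le_total 0 a with h | h
    · rw [abs_of_nonneg h] at ha
      simpa using hconv hx h0 h (sub_nonneg.2 ha) (by ring)
    · rw [abs_of_nonpos h] at ha
      simpa using hconv (hneg x hx) h0 (neg_nonneg.2 h) (sub_nonneg.2 ha) (by ring)
  have habs : Absorbent ℝ S := by
    intro x
    rw [absorbs_iff_norm]
    obtain ⟨l, hl⟩ := hC.exists_smul_add_mem x
    obtain ⟨k, hk⟩ := hC.exists_smul_add_mem (-x)
    set r := max (max l k) 1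
    have hr : 0 < r := lt_of_lt_of_le one_pos (le_max_right _ _)
    refine ⟨r, fun c hc => Set.singleton_subset_iff.2 (hbal.smul_mono
      (by rwa [Real.norm_of_nonneg hr.le] : ‖r‖ ≤ ‖c‖)
      (Set.mem_smul_set.2 ⟨r⁻¹ • x, ⟨?_, ?_⟩, smul_inv_smul₀ hr.ne' x⟩))⟩
    · have := hC.smul_mem r⁻¹ (inv_nonneg.2 hr.le) _ (hC.smul_unit_add_mem_of_le
        ((le_max_left l k).trans (le_max_left _ 1)) hl)
      rwa [smul_add, inv_smul_smul₀ hr.ne'] at this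
    · have := hC.smul_mem r⁻¹ (inv_nonneg.2 hr.le) _ (hC.smul_unit_add_mem_of_le
        ((le_max_right l k).trans (le_max_left _ 1)) hk)
      rwa [smul_add, inv_smul_smul₀ hr.ne', smul_neg, ← sub_eq_add_neg] at this
  -- The gauge of `S` alone defines a locally convex topology, hence one coarser than the finest;
  -- its open unit ball lies in `S`.
  let q : SeminormFamily ℝ E Unit := fun _ => gaugeSeminorm hbal hconv habs
  let t : TopologicalSpace E := q.moduleFilterBasis.topology
  have hq : WithSeminorms q := ⟨rfl⟩
  have ht : finestLocallyConvex E ≤ t :=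
    sInf_le ⟨hq.topologicalAddGroup, hq.continuousSMul, hq.toLocallyConvexSpace⟩
  refine nhds_mono ht (Filter.mem_of_superset
    (hq.hasBasis_zero_ball.mem_of_mem (i := ({()}, 1)) one_pos) fun x hx => ?_)
  rw [Finset.sup_singleton, Seminorm.mem_ball_zero] at hx
  obtain ⟨r, hr0, hr1, y, hy, rfl⟩ := exists_lt_of_gauge_lt habs hx
  simpa using hconv hy h0 hr0.le (sub_nonneg.2 hr1.le) (by ring)

theorem smul_orderInterval_mem_nhds {ε : ℝ} (hε : 0 < ε) :
    {x : E | ε • e + x ∈ C ∧ ε • e - x ∈ C} ∈ @nhds E (finestLocallyConvex E) 0 := by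
  let _ := finestLocallyConvex E
  obtain ⟨h1, h2, h3⟩ := finestLocallyConvex_spec E
  have hS := (set_smul_mem_nhds_zero_iff hε.ne').2 hC.orderInterval_mem_nhds
  refine Filter.mem_of_superset hS ?_
  rintro _ ⟨x, hx, rfl⟩
  constructor
  · have := hC.smul_mem ε hε.le _ hx.1
    rwa [smul_add] at this
  · have := hC.smul_mem ε hε.le _ hx.2
    rwa [smul_sub] at this

/-- An interior point can be moved slightly along `-e`; conversely `ε • e + m` has the neighbourhood
`ε • e + m + [-ε e, ε e]` inside `C`. -/
theorem mem_interior_iff {b : E} : b ∈ @interior _ (finestLocallyConvex E) C ↔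
    ∃ ε : ℝ, 0 < ε ∧ ∃ m ∈ C, b = ε • e + m := by
  let _ := finestLocallyConvex E
  obtain ⟨h1, h2, h3⟩ := finestLocallyConvex_spec E
  rw [mem_interior_iff_mem_nhds]
  constructor
  · intro hb
    have hcont : Continuous fun t : ℝ => b - t • e := by fun_prop
    have hev : ∀ᶠ t in 𝓝 (0 : ℝ), b - t • e ∈ C :=
      hcont.continuousAt.eventually_mem (by simpa using hb)
    obtain ⟨t, ht, ht0⟩ := ((hev.filter_mono nhdsWithin_le_nhds).and
      (self_mem_nhdsWithin (s := Set.Ioi (0 : ℝ)))).exists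
    exact ⟨t, ht0, _, ht, by abel⟩
  · rintro ⟨ε, hε, m, hm, rfl⟩
    have hev : ∀ᶠ x in 𝓝 (ε • e + m), x - (ε • e + m) ∈ {x : E | ε • e + x ∈ C ∧ ε • e - x ∈ C} :=
      (by fun_prop : Continuous fun x : E => x - (ε • e + m)).continuousAt.eventually_mem
        (by simpa using hC.smul_orderInterval_mem_nhds hε)
    filter_upwards [hev] with x hx
    have := hC.add_mem _ hx.1 _ hm
    rwa [show ε • e + (x - (ε • e + m)) + m = x by abel] at this

theorem mem_closure_iff {b : E} : b ∈ @closure _ (finestLocallyConvex E) C ↔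
    ∀ ε : ℝ, 0 < ε → b + ε • e ∈ C := by
  let _ := finestLocallyConvex E
  obtain ⟨h1, h2, h3⟩ := finestLocallyConvex_spec E
  constructor
  · intro hb ε hε
    have hev : ∀ᶠ x in 𝓝 b, x - b ∈ {x : E | ε • e + x ∈ C ∧ ε • e - x ∈ C} :=
      (by fun_prop : Continuous fun x : E => x - b).continuousAt.eventually_mem
        (by simpa using hC.smul_orderInterval_mem_nhds hε)
    obtain ⟨m, hm, hmC⟩ := mem_closure_iff_nhds.1 hb _ hev
    have := hC.add_mem _ hm.2 _ hmC
    rwa [show ε • e - (m - b) + m = b + ε • e by abel] at this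
  · intro h
    have hcont : Continuous fun t : ℝ => b + t • e := by fun_prop
    have hlim : Filter.Tendsto (fun t : ℝ => b + t • e) (𝓝[>] 0) (𝓝 b) := by
      simpa using (hcont.tendsto 0).mono_left (nhdsWithin_le_nhds (s := Set.Ioi (0 : ℝ)))
    exact mem_closure_of_tendsto hlim (Filter.eventually_of_mem self_mem_nhdsWithin h)

end IsOrderUnitCone

end OrderUnit

/-! ### The GNS construction over `𝕜`. -/

section GNS

open UniformSpace Completion ComplexConjugate

variable (𝕜 : Type v) [RCLike 𝕜] (B : Type u) [Ring B] [StarRing B] [Algebra 𝕜 B]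

/-- A hermitian positive semidefinite linear functional on a `*`-algebra whose left multiplication
operators are bounded. -/
structure AdmissibleFunctional where
  /-- The underlying linear functional. -/
  toLinearMap : B →ₗ[𝕜] 𝕜
  map_star : ∀ x, toLinearMap (star x) = conj (toLinearMap x)
  re_nonneg : ∀ x, 0 ≤ RCLike.re (toLinearMap (star x * x))
  bounded : ∀ a, ∃ c : ℝ, 0 ≤ c ∧ ∀ x,
    RCLike.re (toLinearMap (star (a * x) * (a * x))) ≤ c ^ 2 * RCLike.re (toLinearMap (star x * x))

variable {𝕜 B}

namespace AdmissibleFunctional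

/-- The algebra `B`, with the semi-inner product induced by a functional. -/
@[nolint unusedArguments]
def PreGNS (_φ : AdmissibleFunctional 𝕜 B) : Type u := B

variable (φ : AdmissibleFunctional 𝕜 B)

instance : AddCommGroup φ.PreGNS := inferInstanceAs (AddCommGroup B)
instance : Module 𝕜 φ.PreGNS := inferInstanceAs (Module 𝕜 B)

/-- The identity map from the algebra to its semi-inner product space. -/
def toPreGNS : B ≃ₗ[𝕜] φ.PreGNS := LinearEquiv.refl 𝕜 _

/-- The identity map from the semi-inner product space to the algebra. -/
def ofPreGNS : φ.PreGNS ≃ₗ[𝕜] B := φ.toPreGNS.symm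

@[simp]
theorem toPreGNS_ofPreGNS (a : φ.PreGNS) : φ.toPreGNS (φ.ofPreGNS a) = a := rfl

@[simp]
theorem ofPreGNS_toPreGNS (a : B) : φ.ofPreGNS (φ.toPreGNS a) = a := rfl

variable [StarModule 𝕜 B]

/-- The semi-inner product `⟨a, b⟩ = φ (a* b)`. -/
noncomputable abbrev preGNSCore : PreInnerProductSpace.Core 𝕜 φ.PreGNS where
  inner a b := φ.toLinearMap (star (φ.ofPreGNS a) * φ.ofPreGNS b)
  conj_inner_symm a b := by rw [← φ.map_star, star_mul, star_star]
  re_inner_nonneg _ := φ.re_nonneg _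
  add_left _ _ _ := by rw [map_add, star_add, add_mul, map_add]
  smul_left _ _ _ := by simp

noncomputable instance : SeminormedAddCommGroup φ.PreGNS :=
  InnerProductSpace.Core.toSeminormedAddCommGroup (c := φ.preGNSCore)
noncomputable instance : InnerProductSpace 𝕜 φ.PreGNS :=
  InnerProductSpace.ofCore φ.preGNSCore

theorem preGNS_inner_def (a b : φ.PreGNS) :
    inner 𝕜 a b = φ.toLinearMap (star (φ.ofPreGNS a) * φ.ofPreGNS b) := rfl

theorem preGNS_norm_sq (a : φ.PreGNS) :
    ‖a‖ ^ 2 = RCLike.re (φ.toLinearMap (star (φ.ofPreGNS a) * φ.ofPreGNS a)) := by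
  rw [← preGNS_inner_def, norm_sq_eq_re_inner (𝕜 := 𝕜)]

/-- The Hilbert space of a functional. -/
abbrev GNS := UniformSpace.Completion φ.PreGNS

/-- Left multiplication on the semi-inner product space. -/
noncomputable def leftMul (a : B) : φ.PreGNS →L[𝕜] φ.PreGNS :=
  (φ.toPreGNS.toLinearMap ∘ₗ LinearMap.mul 𝕜 B a ∘ₗ φ.ofPreGNS.toLinearMap).mkContinuous
    (φ.bounded a).choose fun x => by
      obtain ⟨hc, h⟩ := (φ.bounded a).choose_spec
      rw [← sq_le_sq₀ (norm_nonneg _) (by positivity), mul_pow, preGNS_norm_sq, preGNS_norm_sq]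
      exact h _

@[simp]
theorem leftMul_apply (a : B) (x : φ.PreGNS) :
    φ.leftMul a x = φ.toPreGNS (a * φ.ofPreGNS x) := rfl

/-- The representation by left multiplication on the Hilbert space of a functional. -/
noncomputable def gnsRep : B →⋆ₐ[𝕜] (φ.GNS →L[𝕜] φ.GNS) where
  toFun a := (φ.leftMul a).completion
  map_one' := by
    ext c
    induction c using induction_on with
    | hp => apply isClosed_eq <;> fun_prop
    | ih c => simp
  map_zero' := by
    ext c
    induction c using induction_on with
    | hp => apply isClosed_eq <;> fun_prop
    | ih c => simp [Completion.coe_zero]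
  map_add' _ _ := by
    ext c
    induction c using induction_on with
    | hp => apply isClosed_eq <;> fun_prop
    | ih c => simp [add_mul, Completion.coe_add]
  map_mul' _ _ := by
    ext c
    induction c using induction_on with
    | hp => apply isClosed_eq <;> fun_prop
    | ih c => simp [mul_assoc]
  commutes' r := by
    ext c
    induction c using induction_on with
    | hp => apply isClosed_eq <;> fun_prop
    | ih c => simp [Algebra.algebraMap_eq_smul_one]
  map_star' a := by
    refine (ContinuousLinearMap.eq_adjoint_iff (φ.leftMul (star a)).completion
      (φ.leftMul a).completion).mpr ?_
    intro x y
    induction x, y using induction_on₂ with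
    | hp => apply isClosed_eq <;> fun_prop
    | ih x y => simp [mul_assoc, preGNS_inner_def]

@[simp]
theorem gnsRep_apply_coe (a : B) (x : φ.PreGNS) :
    φ.gnsRep a x = (φ.toPreGNS (a * φ.ofPreGNS x) : φ.GNS) := by
  simp [gnsRep]

theorem isPositive_gnsRep {a : B} (ha : IsSelfAdjoint a)
    (h : ∀ x, 0 ≤ RCLike.re (φ.toLinearMap (star x * a * x))) : (φ.gnsRep a).IsPositive := by
  rw [ContinuousLinearMap.isPositive_def']
  refine ⟨ha.map φ.gnsRep, fun x => ?_⟩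
  rw [ContinuousLinearMap.reApplyInnerSelf_apply]
  induction x using induction_on with
  | hp => exact isClosed_le continuous_const (by fun_prop)
  | ih x =>
    rw [gnsRep_apply_coe, inner_coe, preGNS_inner_def, ofPreGNS_toPreGNS, star_mul, ha.star_eq]
    exact h _

/-- The canonical cyclic vector. -/
noncomputable def cyclicVector : φ.GNS := (φ.toPreGNS 1 : φ.PreGNS)

theorem inner_cyclicVector (a : B) :
    inner 𝕜 φ.cyclicVector (φ.gnsRep a φ.cyclicVector) = φ.toLinearMap a := by
  rw [cyclicVector, gnsRep_apply_coe, inner_coe, preGNS_inner_def]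
  simp

end AdmissibleFunctional

end GNS

/-! ### Multiplication by central elements; extreme states are factorizable. -/

section States

variable {B : Type*} [Ring B] [StarRing B]

@[simp]
theorem coe_conj (b : B) (m : selfAdjoint B) : (conj b m : B) = star b * m * b := rfl

@[simp]
theorem coe_mulCentral (x y : selfAdjoint B) (hy : (y : B) ∈ Set.center B) :
    (mulCentral x y hy : B) = x * y := rfl

variable {M : Set (selfAdjoint B)}

/-- The iterates of `y ↦ y - y²`. -/
def subSqIterate (y : selfAdjoint B) : ℕ → selfAdjoint B
  | 0 => y
  | n + 1 => subSqIterate y n - conj (subSqIterate y n : B) 1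

/-- The iteration preserves `0 ≤ z ≤ 1`, because `z - z² = (1 - z) z (1 - z) + z (1 - z) z` and `1 -
(z - z²) = (1 - z) + z²`. -/
theorem subSqIterate_mem (hM : IsQuadraticModule M) {y : selfAdjoint B} (hy : y ∈ M)
    (hy1 : 1 - y ∈ M) (n : ℕ) : subSqIterate y n ∈ M ∧ 1 - subSqIterate y n ∈ M := by
  induction n with
  | zero => exact ⟨hy, hy1⟩
  | succ n ih =>
    obtain ⟨h0, h1⟩ := ih
    rw [subSqIterate]
    set z := subSqIterate y n
    constructor
    · convert hM.add_mem _ (hM.conj_mem ((1 - z : selfAdjoint B) : B) z h0) _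
        (hM.conj_mem (z : B) _ h1) using 1
      ext
      simp only [AddSubgroupClass.coe_sub, AddMemClass.coe_add, coe_conj, selfAdjoint.val_one,
        star_sub, star_one, selfAdjoint.star_val_eq]
      noncomm_ring
    · convert hM.add_mem _ h1 _ (hM.conj_mem (z : B) _ hM.one_mem) using 1
      abel

theorem subSqIterate_mem_center {y : selfAdjoint B} (hy : (y : B) ∈ Set.center B) (n : ℕ) :
    (subSqIterate y n : B) ∈ Set.center B := by
  induction n with
  | zero => exact hy
  | succ n ih =>
    rw [← Subring.coe_center, SetLike.mem_coe] at ih ⊢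
    simpa [subSqIterate] using sub_mem ih (mul_mem ih ih)

variable [Algebra ℝ B] [StarModule ℝ B]

theorem natCast_smul_one (l : ℕ) : (l : ℝ) • (1 : selfAdjoint B) = l := by
  ext
  rw [selfAdjoint.val_smul, selfAdjoint.val_one, Nat.cast_smul_eq_nsmul, nsmul_one]
  rfl

/-- The real linear extension to `B` of a functional on the hermitian elements, vanishing on
skew-hermitian elements. -/
noncomputable def hermitianExtension (f : Module.Dual ℝ (selfAdjoint B)) : B →ₗ[ℝ] ℝ :=
  f ∘ₗ selfAdjointPart ℝ

@[simp]
theorem hermitianExtension_coe (f : Module.Dual ℝ (selfAdjoint B)) (x : selfAdjoint B) :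
    hermitianExtension f (x : B) = f x := by
  rw [hermitianExtension, LinearMap.comp_apply, IsSelfAdjoint.selfAdjointPart_apply ℝ x.2]

theorem hermitianExtension_of_eq (f : Module.Dual ℝ (selfAdjoint B)) {a : B} (x : selfAdjoint B)
    (h : (x : B) = a) : hermitianExtension f a = f x := by
  rw [← h, hermitianExtension_coe]

theorem hermitianExtension_star (f : Module.Dual ℝ (selfAdjoint B)) (x : B) :
    hermitianExtension f (star x) = hermitianExtension f x := by
  simp only [hermitianExtension, LinearMap.comp_apply]
  congr 1
  ext
  simp [add_comm]

theorem IsQuadraticModule.smul_mem (hM : IsQuadraticModule M) (c : ℝ) (hc : 0 ≤ c)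
    (m : selfAdjoint B) (hm : m ∈ M) : c • m ∈ M := by
  convert hM.conj_mem (algebraMap ℝ B (Real.sqrt c)) m hm
  ext
  simp only [selfAdjoint.val_smul, coe_conj, Algebra.algebraMap_eq_smul_one, star_smul, star_one,
    star_trivial, smul_mul_assoc, mul_smul_comm, one_mul, mul_one, smul_smul,
    Real.mul_self_sqrt hc]

theorem IsQuadraticModule.isOrderUnitCone (hM : IsQuadraticModule M) (hA : IsArchimedean M) :
    IsOrderUnitCone M (1 : selfAdjoint B) where
  unit_mem := hM.one_mem
  add_mem := hM.add_mem
  smul_mem := hM.smul_mem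
  exists_smul_add_mem x := by
    obtain ⟨l, hl, -⟩ := hA x
    exact ⟨l, by rwa [natCast_smul_one]⟩

variable {f : Module.Dual ℝ (selfAdjoint B)}

theorem sum_conj_subSqIterate (f : Module.Dual ℝ (selfAdjoint B)) (y : selfAdjoint B) (n : ℕ) :
    ∑ k ∈ Finset.range n, f (conj (subSqIterate y k : B) 1) = f y - f (subSqIterate y n) := by
  induction n with
  | zero => simp [subSqIterate]
  | succ n ih =>
    rw [Finset.sum_range_succ, ih, subSqIterate, map_sub]
    ring

/-- The partial sums of `f(yₖ²)` telescope and stay below `f y`, so the terms cannot all be at least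
`δ`. -/
theorem exists_conj_subSqIterate_lt (hM : IsQuadraticModule M) (hf : ∀ m ∈ M, 0 ≤ f m)
    {y : selfAdjoint B} (hy : y ∈ M) (hy1 : 1 - y ∈ M) {δ : ℝ} (hδ : 0 < δ) :
    ∃ n, f (conj (subSqIterate y n : B) 1) < δ := by
  by_contra! h
  obtain ⟨n, hn⟩ := exists_nat_gt (f y / δ)
  rw [div_lt_iff₀ hδ] at hn
  have h1 := sum_conj_subSqIterate f y n
  have h2 : n * δ ≤ ∑ k ∈ Finset.range n, f (conj (subSqIterate y k : B) 1) := by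
    simpa using Finset.sum_le_sum fun k (_ : k ∈ Finset.range n) => h k
  have h3 := hf _ (subSqIterate_mem hM hy hy1 n).1
  linarith

/-- By centrality each iteration lowers the value by `f(yₙ m yₙ) ≥ 0`. -/
theorem hermitianExtension_mul_subSqIterate_le (hM : IsQuadraticModule M)
    (hf : ∀ m ∈ M, 0 ≤ f m) {m y : selfAdjoint B} (hm : m ∈ M) (hyc : (y : B) ∈ Set.center B)
    (n : ℕ) : hermitianExtension f (m * subSqIterate y n) ≤ hermitianExtension f (m * y) := by
  induction n with
  | zero => exact le_rfl
  | succ n ih =>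
    refine le_trans ?_ ih
    have hc := Semigroup.mem_center_iff.1 (subSqIterate_mem_center hyc n) (m : B)
    have h := hf _ (hM.conj_mem (subSqIterate y n : B) m hm)
    rw [← hermitianExtension_coe, coe_conj, selfAdjoint.star_val_eq, ← hc] at h
    rw [subSqIterate, AddSubgroupClass.coe_sub, coe_conj, selfAdjoint.star_val_eq,
      selfAdjoint.val_one, mul_one, mul_sub, map_sub, ← mul_assoc]
    linarith

/-- A positive functional is nonnegative on the product of a positive element and a positive
central element below `1`. -/
theorem hermitianExtension_mul_nonneg (hM : IsQuadraticModule M) (hf : ∀ m ∈ M, 0 ≤ f m)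
    {m y : selfAdjoint B} (hm : m ∈ M) (hy : y ∈ M) (hy1 : 1 - y ∈ M)
    (hyc : (y : B) ∈ Set.center B) : 0 ≤ hermitianExtension f (m * y) := by
  have key : ∀ t : ℝ, 0 < t →
      -(t * (f (conj (m : B) 1) + 1) / 2) ≤ hermitianExtension f (m * y) := by
    intro t ht
    obtain ⟨n, hn⟩ := exists_conj_subSqIterate_lt hM hf hy hy1 (pow_pos ht 2)
    refine le_trans ?_ (hermitianExtension_mul_subSqIterate_le hM hf hm hyc n)
    have hc := Semigroup.mem_center_iff.1 (subSqIterate_mem_center hyc n) (m : B)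
    set z := subSqIterate y n
    -- A Cauchy–Schwarz argument: expanding `f((t m + z)²) ≥ 0` with `f(z²) < t²` and dividing by
    -- `2t` bounds `f(m z)` from below.
    have h := hf _ (hM.conj_mem ((t • m + z : selfAdjoint B) : B) 1 hM.one_mem)
    have he : f (conj ((t • m + z : selfAdjoint B) : B) 1) =
        t ^ 2 * f (conj (m : B) 1) + 2 * t * hermitianExtension f (m * z) +
          f (conj (z : B) 1) := by
      simp only [← hermitianExtension_coe, coe_conj, star_add, star_smul, star_trivial,
        selfAdjoint.star_val_eq, selfAdjoint.val_one, mul_one, AddMemClass.coe_add,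
        selfAdjoint.val_smul, add_mul, mul_add, map_add, smul_mul_assoc, mul_smul_comm, map_smul,
        smul_eq_mul, ← hc]
      ring
    rw [he] at h
    have h2 : 0 ≤ t * (t * (f (conj (m : B) 1) + 1) / 2 + hermitianExtension f (m * z)) := by
      nlinarith
    have := nonneg_of_mul_nonneg_right h2 ht
    linarith
  have hA : 0 ≤ f (conj (m : B) 1) := hf _ (hM.conj_mem _ _ hM.one_mem)
  refine le_of_forall_pos_lt_add fun ε hε => ?_
  have := key (ε / (f (conj (m : B) 1) + 1)) (by positivity)
  rw [div_mul_cancel₀ _ (by positivity)] at this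
  linarith

/-- As `f y = 0`, adding a multiple of `1` to `x` does not change `f(x y)`. So `x` may be taken in
`M`, and likewise `-x`. -/
theorem hermitianExtension_mul_eq_zero (hM : IsQuadraticModule M) (hA : IsArchimedean M)
    (hf : ∀ m ∈ M, 0 ≤ f m) {y : selfAdjoint B} (hy : y ∈ M) (hy1 : 1 - y ∈ M)
    (hyc : (y : B) ∈ Set.center B) (h0 : f y = 0) (x : selfAdjoint B) :
    hermitianExtension f (x * y) = 0 := by
  have key : ∀ x : selfAdjoint B, 0 ≤ hermitianExtension f (x * y) := by
    intro x
    obtain ⟨l, hl⟩ := (hM.isOrderUnitCone hA).exists_smul_add_mem x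
    have := hermitianExtension_mul_nonneg hM hf hl hy hy1 hyc
    simpa [add_mul, h0] using this
  have h := key (-x)
  rw [NegMemClass.coe_neg, neg_mul, map_neg] at h
  linarith [key x]

/-- The functional `x ↦ f (x y)` on hermitian elements. -/
noncomputable def mulRightFunctional (f : Module.Dual ℝ (selfAdjoint B)) (y : B) :
    Module.Dual ℝ (selfAdjoint B) :=
  hermitianExtension f ∘ₗ LinearMap.mulRight ℝ y ∘ₗ (selfAdjoint.submodule ℝ B).subtype

@[simp]
theorem mulRightFunctional_apply (f : Module.Dual ℝ (selfAdjoint B)) (y : B)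
    (x : selfAdjoint B) : mulRightFunctional f y x = hermitianExtension f (x * y) := rfl

theorem mulRightFunctional_mem_positiveStates (hM : IsQuadraticModule M)
    (hf : f ∈ positiveStates M) {y : selfAdjoint B} (hy : y ∈ M) (hy1 : 1 - y ∈ M)
    (hyc : (y : B) ∈ Set.center B) (h0 : 0 < f y) :
    (f y)⁻¹ • mulRightFunctional f y ∈ positiveStates M := by
  constructor
  · simp [h0.ne']
  · intro m hm
    exact mul_nonneg (inv_nonneg.2 h0.le) (hermitianExtension_mul_nonneg hM hf.2 hm hy hy1 hyc)

theorem hermitianExtension_mul_of_mem_extremeStates_of_le (hM : IsQuadraticModule M)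
    (hA : IsArchimedean M) (hf : f ∈ extremeStates M) {y : selfAdjoint B} (hy : y ∈ M)
    (hy1 : 1 - y ∈ M) (hyc : (y : B) ∈ Set.center B) (x : selfAdjoint B) :
    hermitianExtension f (x * y) = f x * f y := by
  have hfs : f ∈ positiveStates M := hf.1
  have hyc1 : ((1 - y : selfAdjoint B) : B) ∈ Set.center B := by
    rw [← Subring.coe_center, SetLike.mem_coe] at hyc ⊢
    simpa using sub_mem (one_mem _) hyc
  have hy2 : 1 - (1 - y) ∈ M := by simpa using hy
  have hsub : f (1 - y) = 1 - f y := by rw [map_sub, hfs.1]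
  have hmul : hermitianExtension f (x * (1 - y : selfAdjoint B)) =
      f x - hermitianExtension f (x * y) := by
    simp [mul_sub]
  rcases (hfs.2 y hy).eq_or_lt' with h0 | h0
  · rw [hermitianExtension_mul_eq_zero hM hA hfs.2 hy hy1 hyc h0, h0, mul_zero]
  rcases (hfs.2 _ hy1).eq_or_lt' with h1 | h1
  · have := hermitianExtension_mul_eq_zero hM hA hfs.2 hy1 hy2 hyc1 h1 x
    rw [hmul] at this
    rw [show f y = 1 by linarith, mul_one]
    linarith
  have hg := mulRightFunctional_mem_positiveStates hM hfs hy hy1 hyc h0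
  have hg' := mulRightFunctional_mem_positiveStates hM hfs hy1 hy2 hyc1 h1
  -- The weights `f y` and `f (1 - y)` cancel the normalizations; extremality then forces `f(· y) /
  -- f y = f`.
  have hseg : f ∈ openSegment ℝ ((f y)⁻¹ • mulRightFunctional f y)
      ((f (1 - y))⁻¹ • mulRightFunctional f (1 - y : selfAdjoint B)) := by
    refine ⟨f y, f (1 - y), h0, h1, by rw [hsub]; ring, ?_⟩
    rw [smul_inv_smul₀ h0.ne', smul_inv_smul₀ h1.ne']
    ext z
    simp [mul_sub]
  have heq := (mem_extremePoints_iff_left.1 hf).2 _ hg _ hg' hseg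
  have := LinearMap.congr_fun heq x
  rw [LinearMap.smul_apply, mulRightFunctional_apply, smul_eq_mul] at this
  rw [← this]
  field_simp

/-- Extreme positive states are factorizable. -/
theorem isFactorizable_of_mem_extremeStates (hM : IsQuadraticModule M) (hA : IsArchimedean M)
    (hf : f ∈ extremeStates M) : IsFactorizable f := by
  intro x y hyc
  rw [← hermitianExtension_coe, coe_mulCentral]
  have hC := hM.isOrderUnitCone hA
  obtain ⟨l, hl, hl'⟩ := hA y
  -- The extra `1` makes `c` positive even if `l = 0`, so that `z = (c + y) / (2c)` lies between `0`
  -- and `1`. Factorization is affine in `y` and passes back from `z`.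
  set c : ℝ := l + 1
  have hc : 0 < c := by positivity
  have hlc : (l : ℝ) ≤ c := by simp [c]
  have h1 : c • 1 + y ∈ M := hC.smul_unit_add_mem_of_le hlc (by rwa [natCast_smul_one])
  have h2 : c • 1 + -y ∈ M :=
    hC.smul_unit_add_mem_of_le hlc (by rwa [natCast_smul_one, ← sub_eq_add_neg])
  have hc2 : 0 ≤ (2 * c)⁻¹ := by positivity
  set z : selfAdjoint B := (2 * c)⁻¹ • (c • 1 + y) with hz
  have hz1 : 1 - z = (2 * c)⁻¹ • (c • 1 + -y) := by
    rw [sub_eq_iff_eq_add, hz, ← smul_add,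
      show c • (1 : selfAdjoint B) + -y + (c • 1 + y) = (2 * c) • 1 by module,
      inv_smul_smul₀ (by positivity)]
  have hzc : (z : B) ∈ Set.center B := by
    change _ ∈ Subalgebra.center ℝ B
    change _ ∈ Subalgebra.center ℝ B at hyc
    rw [hz, selfAdjoint.val_smul, AddMemClass.coe_add, selfAdjoint.val_smul, selfAdjoint.val_one]
    exact Subalgebra.smul_mem _ (add_mem (Subalgebra.smul_mem _ (one_mem _) _) hyc) _
  have hmain := hermitianExtension_mul_of_mem_extremeStates_of_le hM hA hf (y := z)
    (hM.smul_mem _ hc2 _ h1) (by rw [hz1]; exact hM.smul_mem _ hc2 _ h2) hzc x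
  have hf1 : f 1 = 1 := hf.1.1
  simp only [hz, selfAdjoint.val_smul, AddMemClass.coe_add, selfAdjoint.val_one, mul_add,
    mul_smul_comm, mul_one, map_add, map_smul, smul_eq_mul, hf1, hermitianExtension_coe] at hmain
  field_simp at hmain
  linarith

end States

/-! ### The weak* topology on the algebraic dual. -/

section WeakStar

variable {E : Type*} [AddCommGroup E] [Module ℝ E]

theorem isEmbedding_weakStar :
    @IsEmbedding _ _ (weakStar E) _ (fun (f : Module.Dual ℝ E) (x : E) => f x) :=
  letI := weakStar E
  ⟨⟨rfl⟩, DFunLike.coe_injective⟩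

theorem continuous_eval_weakStar (x : E) :
    @Continuous _ _ (weakStar E) _ (fun f : Module.Dual ℝ E => f x) :=
  letI := weakStar E
  (continuous_apply x).comp isEmbedding_weakStar.continuous

theorem isClosed_range_weakStar :
    IsClosed (Set.range (fun (f : Module.Dual ℝ E) (x : E) => f x)) :=
  LinearMap.isClosed_range_coe E ℝ (RingHom.id ℝ)

end WeakStar

/-! ### Compactness of the state space and existence of extreme minimizers. -/

section KreinMilman

variable {B : Type*} [Ring B] [StarRing B] [Algebra ℝ B] [StarModule ℝ B]
  {M : Set (selfAdjoint B)}

theorem isClosed_positiveStates : @IsClosed _ (weakStar (selfAdjoint B)) (positiveStates M) := by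
  let _ := weakStar (selfAdjoint B)
  have : positiveStates M =
      {f | f 1 = 1} ∩ ⋂ m ∈ M, {f : Module.Dual ℝ (selfAdjoint B) | 0 ≤ f m} := by
    ext f
    simp [positiveStates]
  rw [this]
  exact (isClosed_eq (continuous_eval_weakStar 1) continuous_const).inter
    (isClosed_biInter fun m _ => isClosed_le continuous_const (continuous_eval_weakStar m))

/-- As in Banach–Alaoglu: the archimedean bounds confine states to a product of intervals `[-l x, l
x]`, compact by Tychonoff. -/
theorem isCompact_positiveStates (hA : IsArchimedean M) :
    @IsCompact _ (weakStar (selfAdjoint B)) (positiveStates M) := by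
  let _ := weakStar (selfAdjoint B)
  choose l hl hl' using hA
  have hK : IsCompact (Set.pi Set.univ fun x : selfAdjoint B => Set.Icc (-(l x : ℝ)) (l x)) :=
    isCompact_univ_pi fun x => isCompact_Icc
  have hemb : IsClosedEmbedding (fun (f : Module.Dual ℝ (selfAdjoint B)) x => f x) :=
    ⟨isEmbedding_weakStar, isClosed_range_weakStar⟩
  refine (hemb.isCompact_preimage hK).of_isClosed_subset isClosed_positiveStates ?_
  rintro f ⟨hf1, hf⟩ x -
  have hcast : f (l x : selfAdjoint B) = l x := by
    rw [← natCast_smul_one, map_smul, hf1, smul_eq_mul, mul_one]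
  have h1 := hf _ (hl x)
  have h2 := hf _ (hl' x)
  rw [map_add, hcast] at h1
  rw [map_sub, hcast] at h2
  exact ⟨by linarith, by linarith⟩

/-- Some extreme state takes at `b` a value at most that of a given state. -/
theorem exists_mem_extremeStates_le (hA : IsArchimedean M) {f : Module.Dual ℝ (selfAdjoint B)}
    (hf : f ∈ positiveStates M) (b : selfAdjoint B) : ∃ g ∈ extremeStates M, g b ≤ f b := by
  let _ := weakStar (selfAdjoint B)
  let ι : Module.Dual ℝ (selfAdjoint B) →ₗ[ℝ] (selfAdjoint B → ℝ) :=
    { toFun := fun f x => f x, map_add' := fun _ _ => rfl, map_smul' := fun _ _ => rfl }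
  have : IsTopologicalAddGroup (Module.Dual ℝ (selfAdjoint B)) := topologicalAddGroup_induced ι
  have : ContinuousSMul ℝ (Module.Dual ℝ (selfAdjoint B)) := continuousSMul_induced ι
  have : LocallyConvexSpace ℝ (Module.Dual ℝ (selfAdjoint B)) := LocallyConvexSpace.induced ι
  have : T2Space (Module.Dual ℝ (selfAdjoint B)) := isEmbedding_weakStar.t2Space
  have hcont := continuous_eval_weakStar b
  have hcompact := isCompact_positiveStates hA
  -- `toExposed` selects maximizers, hence the sign. The minimizers form a nonempty compact face,
  -- whose extreme points are extreme in the whole set.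
  let ev : Module.Dual ℝ (selfAdjoint B) →L[ℝ] ℝ :=
    ⟨-Module.Dual.eval ℝ (selfAdjoint B) b, hcont.neg⟩
  have hexp : IsExposed ℝ (positiveStates M) (ev.toExposed (positiveStates M)) :=
    ContinuousLinearMap.toExposed.isExposed
  obtain ⟨g₀, hg₀, hmin⟩ := hcompact.exists_isMinOn ⟨f, hf⟩ hcont.continuousOn
  have hne : (ev.toExposed (positiveStates M)).Nonempty :=
    ⟨g₀, hg₀, fun h hh => neg_le_neg (hmin hh)⟩
  obtain ⟨g, hg⟩ := (hexp.isCompact hcompact).extremePoints_nonempty hne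
  exact ⟨g, hexp.isExtreme.extremePoints_subset_extremePoints hg,
    neg_le_neg_iff.1 (hg.1.2 f hf)⟩

theorem closure_extremeStates_subset :
    @closure _ (weakStar (selfAdjoint B)) (extremeStates M) ⊆ positiveStates M :=
  letI := weakStar (selfAdjoint B)
  closure_minimal extremePoints_subset isClosed_positiveStates

end KreinMilman

/-! ### Passage between states and `M`-positive representations. -/

section Representations

variable {𝕜 : Type v} [RCLike 𝕜] {B : Type u} [Ring B] [StarRing B]
  [Algebra 𝕜 B] [Algebra ℝ B] [IsScalarTower ℝ 𝕜 B] [StarModule ℝ B]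
  {M : Set (selfAdjoint B)} {f : Module.Dual ℝ (selfAdjoint B)}

theorem re_extendRCLike_hermitianExtension (f : Module.Dual ℝ (selfAdjoint B)) (x : B) :
    RCLike.re (Module.Dual.extendRCLike (𝕜 := 𝕜) (hermitianExtension f) x) =
      hermitianExtension f x :=
  Module.Dual.re_extendRCLike_apply _ _

theorem map_smul_one_eq {H : Type*} [NormedAddCommGroup H] [InnerProductSpace 𝕜 H]
    [CompleteSpace H] (π : B →⋆ₐ[𝕜] (H →L[𝕜] H)) (ε : ℝ) :
    π ((ε • (1 : selfAdjoint B) : selfAdjoint B) : B) = (ε : 𝕜) • (1 : H →L[𝕜] H) := by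
  rw [selfAdjoint.val_smul, selfAdjoint.val_one, ← algebraMap_smul 𝕜 ε (1 : B), map_smul, map_one]

theorem isStrictlyPositiveOp_of_eq_smul_add {H : Type*} [NormedAddCommGroup H]
    [InnerProductSpace 𝕜 H] [CompleteSpace H] {π : B →⋆ₐ[𝕜] (H →L[𝕜] H)}
    (hπ : IsPositiveRep M π) {b : selfAdjoint B}
    (h : ∃ ε : ℝ, 0 < ε ∧ ∃ m ∈ M, b = ε • (1 : selfAdjoint B) + m) :
    IsStrictlyPositiveOp (π (b : B)) := by
  obtain ⟨ε, hε, m, hm, rfl⟩ := h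
  refine ⟨ε, hε, ?_⟩
  rw [AddMemClass.coe_add, map_add, map_smul_one_eq, add_sub_cancel_left]
  exact hπ m hm

theorem isPositive_of_forall_add_smul_mem {H : Type*} [NormedAddCommGroup H]
    [InnerProductSpace 𝕜 H] [CompleteSpace H] {π : B →⋆ₐ[𝕜] (H →L[𝕜] H)}
    (hπ : IsPositiveRep M π) {b : selfAdjoint B}
    (h : ∀ ε : ℝ, 0 < ε → b + ε • (1 : selfAdjoint B) ∈ M) : (π (b : B)).IsPositive := by
  rw [ContinuousLinearMap.isPositive_def']
  refine ⟨IsSelfAdjoint.map b.2 π, fun x => ?_⟩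
  have key : ∀ ε : ℝ, 0 < ε → 0 ≤ (π (b : B)).reApplyInnerSelf x + ε * ‖x‖ ^ 2 := by
    intro ε hε
    have h1 := (hπ _ (h ε hε)).re_inner_nonneg_left x
    rw [AddMemClass.coe_add, map_add, map_smul_one_eq, add_apply,
      inner_add_left, map_add, smul_apply, inner_smul_left, RCLike.conj_ofReal,
      RCLike.re_ofReal_mul, one_apply_eq_self, inner_self_eq_norm_sq] at h1
    exact h1
  refine le_of_forall_pos_le_add fun δ hδ => ?_
  -- The `+ 1` avoids a zero denominator at `x = 0`.
  refine (key (δ / (‖x‖ ^ 2 + 1)) (by positivity)).trans ?_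
  gcongr
  rw [div_mul_eq_mul_div, div_le_iff₀ (by positivity)]
  nlinarith

variable [StarModule 𝕜 B]

theorem extendRCLike_hermitianExtension_star (f : Module.Dual ℝ (selfAdjoint B)) (x : B) :
    Module.Dual.extendRCLike (𝕜 := 𝕜) (hermitianExtension f) (star x) =
      starRingEnd 𝕜 (Module.Dual.extendRCLike (𝕜 := 𝕜) (hermitianExtension f) x) := by
  have h : hermitianExtension f ((RCLike.I : 𝕜) • star x) =
      -hermitianExtension f ((RCLike.I : 𝕜) • x) := by
    rw [← hermitianExtension_star f ((RCLike.I : 𝕜) • star x), star_smul, star_star,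
      RCLike.star_def, RCLike.conj_I, neg_smul, map_neg]
  rw [Module.Dual.extendRCLike_apply, Module.Dual.extendRCLike_apply, hermitianExtension_star, h]
  simp

variable (𝕜) in
/-- The admissible functional on `B` attached to a positive state. -/
noncomputable def stateFunctional (hM : IsQuadraticModule M) (hA : IsArchimedean M)
    (hf : f ∈ positiveStates M) : AdmissibleFunctional 𝕜 B where
  toLinearMap := Module.Dual.extendRCLike (hermitianExtension f)
  map_star := extendRCLike_hermitianExtension_star f
  re_nonneg x := by
    rw [re_extendRCLike_hermitianExtension,
      hermitianExtension_of_eq f (conj x 1) (by simp)]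
    exact hf.2 _ (hM.conj_mem _ _ hM.one_mem)
  bounded a := by
    -- Conjugating `l - a* a ∈ M` by `x` gives `f((a x)* (a x)) ≤ l f(x* x)`, so `√l` bounds left
    -- multiplication.
    obtain ⟨l, -, hl⟩ := hA (conj a 1)
    refine ⟨Real.sqrt l, Real.sqrt_nonneg _, fun x => ?_⟩
    have h := hf.2 _ (hM.conj_mem x _ hl)
    rw [← natCast_smul_one, ← hermitianExtension_coe, coe_conj] at h
    simp only [AddSubgroupClass.coe_sub, selfAdjoint.val_smul, selfAdjoint.val_one, coe_conj,
      mul_one, mul_sub, sub_mul, mul_smul_comm, smul_mul_assoc, map_sub, map_smul,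
      smul_eq_mul] at h
    rw [re_extendRCLike_hermitianExtension, re_extendRCLike_hermitianExtension,
      Real.sq_sqrt l.cast_nonneg, star_mul]
    simp only [mul_assoc] at h ⊢
    linarith

variable (hM : IsQuadraticModule M) (hA : IsArchimedean M) (hf : f ∈ positiveStates M)

theorem isPositiveRep_gnsRep : IsPositiveRep M (stateFunctional 𝕜 hM hA hf).gnsRep := by
  intro m hm
  refine AdmissibleFunctional.isPositive_gnsRep _ m.2 fun x => ?_
  change 0 ≤ RCLike.re (Module.Dual.extendRCLike (𝕜 := 𝕜) (hermitianExtension f) _)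
  rw [re_extendRCLike_hermitianExtension, hermitianExtension_of_eq f (conj x m) (coe_conj x m)]
  exact hf.2 _ (hM.conj_mem _ _ hm)

theorem re_inner_cyclicVector_gnsRep (b : selfAdjoint B) :
    RCLike.re (inner 𝕜 (stateFunctional 𝕜 hM hA hf).cyclicVector
      ((stateFunctional 𝕜 hM hA hf).gnsRep (b : B)
        (stateFunctional 𝕜 hM hA hf).cyclicVector)) = f b := by
  rw [AdmissibleFunctional.inner_cyclicVector]
  exact (re_extendRCLike_hermitianExtension f _).trans (hermitianExtension_coe f b)

-- The GNS space is a completion of `B`, so it lives in `Type u`, and testing Hilbert spaces in that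
-- universe suffices.
include hM hA hf in
theorem nonneg_of_forall_isPositive {b : selfAdjoint B}
    (h : ∀ (H : Type u) [NormedAddCommGroup H] [InnerProductSpace 𝕜 H] [CompleteSpace H]
      (π : B →⋆ₐ[𝕜] (H →L[𝕜] H)), IsPositiveRep M π → (π (b : B)).IsPositive) : 0 ≤ f b := by
  rw [← re_inner_cyclicVector_gnsRep (𝕜 := 𝕜) hM hA hf b]
  exact (h _ _ (isPositiveRep_gnsRep hM hA hf)).re_inner_nonneg_right _

include hM hA hf in
theorem pos_of_forall_isStrictlyPositiveOp {b : selfAdjoint B}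
    (h : ∀ (H : Type u) [NormedAddCommGroup H] [InnerProductSpace 𝕜 H] [CompleteSpace H]
      (π : B →⋆ₐ[𝕜] (H →L[𝕜] H)), IsPositiveRep M π → IsStrictlyPositiveOp (π (b : B))) :
    0 < f b := by
  obtain ⟨ε, hε, hpos⟩ := h _ _ (isPositiveRep_gnsRep (𝕜 := 𝕜) hM hA hf)
  have h1 := hpos.re_inner_nonneg_right (stateFunctional 𝕜 hM hA hf).cyclicVector
  -- The cyclic vector has norm one because `f 1 = 1`, so the gap `ε` passes to `f b ≥ ε`.
  have h2 := re_inner_cyclicVector_gnsRep (𝕜 := 𝕜) hM hA hf 1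
  rw [selfAdjoint.val_one, map_one, hf.1, one_apply_eq_self] at h2
  rw [sub_apply, inner_sub_right, map_sub, re_inner_cyclicVector_gnsRep,
    smul_apply, inner_smul_right, RCLike.re_ofReal_mul,
    one_apply_eq_self, h2] at h1
  linarith

end Representations

end StarPositivity

open StarPositivity

/-- The ground field `𝕜` is `ℝ` or `ℂ`. The real algebra structure on `B` is the one restricted
from `𝕜`. -/
theorem mainTheorem2 {𝕜 : Type v} [RCLike 𝕜] {B : Type u} [Ring B] [StarRing B]
    [Algebra 𝕜 B] [StarModule 𝕜 B] [Algebra ℝ B] [IsScalarTower ℝ 𝕜 B] [StarModule ℝ B]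
    (M : Set (selfAdjoint B)) (hM : StarPositivity.IsQuadraticModule M)
    (hA : StarPositivity.IsArchimedean M) (b : selfAdjoint B) :
    List.TFAE [
      b ∈ @interior _ (StarPositivity.finestLocallyConvex (selfAdjoint B)) M,
      ∃ ε : ℝ, 0 < ε ∧ ∃ m ∈ M, b = ε • (1 : selfAdjoint B) + m,
      ∀ (H : Type u) [NormedAddCommGroup H] [InnerProductSpace 𝕜 H] [CompleteSpace H]
        (π : B →⋆ₐ[𝕜] (H →L[𝕜] H)), StarPositivity.IsPositiveRep M π →
          StarPositivity.IsStrictlyPositiveOp (π (b : B)),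
      ∀ f ∈ StarPositivity.positiveStates M, 0 < f b,
      ∀ f ∈ @closure _ (StarPositivity.weakStar (selfAdjoint B)) (StarPositivity.extremeStates M),
        0 < f b,
      ∀ f ∈ StarPositivity.positiveStates M, StarPositivity.IsFactorizable f → 0 < f b] ∧
    List.TFAE [
      b ∈ @closure _ (StarPositivity.finestLocallyConvex (selfAdjoint B)) M,
      ∀ ε : ℝ, 0 < ε → b + ε • (1 : selfAdjoint B) ∈ M,
      ∀ (H : Type u) [NormedAddCommGroup H] [InnerProductSpace 𝕜 H] [CompleteSpace H]
        (π : B →⋆ₐ[𝕜] (H →L[𝕜] H)), StarPositivity.IsPositiveRep M π →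
          (π (b : B)).IsPositive,
      ∀ f ∈ StarPositivity.positiveStates M, 0 ≤ f b,
      ∀ f ∈ @closure _ (StarPositivity.weakStar (selfAdjoint B)) (StarPositivity.extremeStates M),
        0 ≤ f b,
      ∀ f ∈ StarPositivity.positiveStates M, StarPositivity.IsFactorizable f → 0 ≤ f b] := by
  have hC := hM.isOrderUnitCone hA
  constructor
  · tfae_have 1 ↔ 2 := hC.mem_interior_iff
    tfae_have 2 → 3 := fun h H _ _ _ π hπ => isStrictlyPositiveOp_of_eq_smul_add hπ h
    tfae_have 3 → 4 := fun h f hf => pos_of_forall_isStrictlyPositiveOp hM hA hf h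
    tfae_have 4 → 2 := fun h => hC.exists_eq_smul_add_of_forall_pos fun f h1 hf => h f ⟨h1, hf⟩
    tfae_have 4 → 5 := fun h f hf => h f (closure_extremeStates_subset hf)
    tfae_have 5 → 4 := fun h f hf => by
      obtain ⟨g, hg, hgf⟩ := exists_mem_extremeStates_le hA hf b
      exact (h g (@subset_closure _ (weakStar (selfAdjoint B)) _ _ hg)).trans_le hgf
    tfae_have 4 → 6 := fun h f hf _ => h f hf
    tfae_have 6 → 4 := fun h f hf => by
      obtain ⟨g, hg, hgf⟩ := exists_mem_extremeStates_le hA hf b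
      exact (h g hg.1 (isFactorizable_of_mem_extremeStates hM hA hg)).trans_le hgf
    tfae_finish
  · tfae_have 1 ↔ 2 := hC.mem_closure_iff
    tfae_have 2 → 3 := fun h H _ _ _ π hπ => isPositive_of_forall_add_smul_mem hπ h
    tfae_have 3 → 4 := fun h f hf => nonneg_of_forall_isPositive hM hA hf h
    tfae_have 4 → 2 := fun h ε hε =>
      hC.add_smul_mem_of_forall_nonneg (fun f h1 hf => h f ⟨h1, hf⟩) hε
    tfae_have 4 → 5 := fun h f hf => h f (closure_extremeStates_subset hf)
    tfae_have 5 → 4 := fun h f hf => by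
      obtain ⟨g, hg, hgf⟩ := exists_mem_extremeStates_le hA hf b
      exact (h g (@subset_closure _ (weakStar (selfAdjoint B)) _ _ hg)).trans hgf
    tfae_have 4 → 6 := fun h f hf _ => h f hf
    tfae_have 6 → 4 := fun h f hf => by
      obtain ⟨g, hg, hgf⟩ := exists_mem_extremeStates_le hA hf b
      exact (h g hg.1 (isFactorizable_of_mem_extremeStates hM hA hg)).trans hgf
    tfae_finish
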